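/- For a real number $\beta>1$ let $T(x)=\{\beta x\}$ (fractional part) for $x\in[0,1]$, and let $d_\beta(x)=c_1c_2\cdots$ with $c_n=\lfloor \beta\, T^{n-1}(x)\rfloor$. For a real number $x\ge 0$ let $L(x)=\min\{n\in\mathbb{Z}_{\ge 0} : x\beta^{-n}<1\}$. One says that $x$ has a finite beta-expansion in base $\beta$ if only finitely many digits of $d_\beta(\beta^{-L(x)}x)$ are nonzero, and $\mathrm{Fin}(\beta)$ denotes the set of all such $x \geq 0$. The number $\beta$ has property (F$_1$) if $\mathbb{Z}_{\ge 0}\subset \mathrm{Fin}(\beta)$, and property (PF) if $\mathbb{Z}_{\ge 0}[1/\beta]\subset \mathrm{Fin}(\beta)$, where $\mathbb{Z}_{\ge 0}[1/\beta]$ is the set of all finite sums $\sum_{i=0}^{m} a_i\beta^{-i}$ with nonnegative integers $a_i$. Theorem. For every integer $t\ge 2$, the polynomial $x^3-2tx^2+2tx-t$ has exactly one real root $\beta>1$, and this $\beta$ has property (F$_1$) but does not have property (PF). -/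

import Mathlib

/-- The `β`-transformation `T(x) = {βx}`. -/
noncomputable def betaT (β x : ℝ) : ℝ :=
  Int.fract (β * x)

/-- The digits of `d_β(x) = c₁ c₂ c₃ ⋯`, indexed from `0`:
`betaDigit β x n` is `c_{n+1} = ⌊β Tⁿ(x)⌋`. -/
noncomputable def betaDigit (β x : ℝ) (n : ℕ) : ℤ :=
  ⌊β * (betaT β)^[n] x⌋

/-- `L(x) = min {n ∈ ℕ₀ | x β⁻ⁿ < 1}`. -/
noncomputable def betaL (β x : ℝ) : ℕ :=
  sInf {n : ℕ | x / β ^ n < 1}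

/-- `Fin(β)`: the nonnegative reals `x` whose `β`-expansion, which has the digits of
`d_β(β^{-L(x)} x)`, has only finitely many nonzero digits. -/
def betaFin (β : ℝ) : Set ℝ :=
  {x | 0 ≤ x ∧ {n : ℕ | betaDigit β (x / β ^ betaL β x) n ≠ 0}.Finite}

/-- Property (F₁): `ℕ₀ ⊆ Fin(β)`. -/
def PropertyF1 (β : ℝ) : Prop :=
  ∀ N : ℕ, (N : ℝ) ∈ betaFin β

/-- Property (PF): `ℕ₀[1/β] ⊆ Fin(β)`, where `ℕ₀[1/β]` is the set of polynomial expressions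
in `1/β` with coefficients in `ℕ₀`. -/
def PropertyPF (β : ℝ) : Prop :=
  (Algebra.adjoin ℕ {1 / β} : Set ℝ) ⊆ betaFin β

/-! With r = t/β and u = 2t − β, every `fract (r * A - u * B)` has its `betaT`-orbit encoded by
integers with a(n+2) = ρ + u a(n+1) − r a(n), 0 ≤ ρ < 1 (`betaT_iterate_fract`). Four steps of this
recurrence contract (`four_step`), so the integers end in a small window, where excluding
transitions leaves only the fixed points (0, 0) and (1, 1) (`exists_fixed`). The first is the number
0; the second is (t − 1)/(β − 1), whose digits are all t − 1. That number is a nonnegative integer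
polynomial in 1/β, so (PF) fails.

For (F₁), an integer N must avoid (1, 1). This point is its own only preimage, so it suffices to
check the coordinates after the first L = L(N) steps. An inhomogeneous term y βⁿ with y = N/β^L
carries the recurrence through those steps, and a growth estimate excludes (1, 1)
(`radixSeq_ne_one`). -/

/-- The inhomogeneous shift radix system: `a (n + 2) = -⌊y βⁿ + r a n - u a (n + 1)⌋`,
with `a 0 = A` and `a 1 = B`. -/
noncomputable def radixSeq (β r u y : ℝ) (A B : ℤ) : ℕ → ℤ
  | 0 => A
  | 1 => B
  | n + 2 => -⌊y * β ^ n + r * radixSeq β r u y A B n - u * radixSeq β r u y A B (n + 1)⌋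

theorem radixSeq_add_two (β r u y : ℝ) (A B : ℤ) (n : ℕ) :
    (radixSeq β r u y A B (n + 2) : ℝ) =
      Int.fract (y * β ^ n + r * radixSeq β r u y A B n - u * radixSeq β r u y A B (n + 1))
        - y * β ^ n + u * radixSeq β r u y A B (n + 1) - r * radixSeq β r u y A B n := by
  rw [radixSeq, Int.fract]
  push_cast
  ring

/-- The `β`-transformation is conjugate to the shift radix system. -/
theorem betaT_iterate_fract {β r u : ℝ} {t : ℕ} (hr : β * r = t) (hu : β * u = 2 * t - r)
    (hβ : β = 2 * t - u) (y : ℝ) (A B : ℤ) (n : ℕ) :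
    (betaT β)^[n] (Int.fract (y + r * A - u * B)) =
      Int.fract (y * β ^ n + r * radixSeq β r u y A B n - u * radixSeq β r u y A B (n + 1)) := by
  induction n with
  | zero => simp [radixSeq]
  | succ n ih =>
    rw [Function.iterate_succ_apply', ih, betaT, Int.fract_eq_fract]
    have h := radixSeq_add_two β r u y A B n
    set a := radixSeq β r u y A B
    -- The integer part lost on multiplying by β, read off from βr = t, βu = 2t − r and β + u = 2t.
    refine ⟨t * a n - 2 * t * a (n + 1) + 2 * t * a (n + 2), ?_⟩
    push_cast
    rw [show Int.fract (y * β ^ n + r * (a n : ℝ) - u * (a (n + 1) : ℝ)) =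
      a (n + 2) + y * β ^ n - u * a (n + 1) + r * a n by linarith]
    linear_combination (a n : ℝ) * hr - (a (n + 1) : ℝ) * hu + (a (n + 2) : ℝ) * hβ

/-! ### Numerical bounds on the coefficients -/

/-- The admissible coefficients `(r, u)` of the shift radix system, on a curve parametrised
by `v`. -/
structure RadixParam (v r u : ℝ) : Prop where
  lower : 9 / 14 < v
  upper : v < 1
  r_mul : r * (1 + v ^ 2) = 1
  u_eq : u = r * (1 + v)

namespace RadixParam

variable {v r u : ℝ}

theorem r_pos (h : RadixParam v r u) : 0 < r := by
  have := h.r_mul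
  by_contra hr
  nlinarith [sq_nonneg v]

theorem r_gt (h : RadixParam v r u) : 1 / 2 < r := by
  nlinarith [h.r_mul, h.lower, h.upper, h.r_pos]

theorem r_lt (h : RadixParam v r u) : r < 71 / 100 := by
  nlinarith [h.r_mul, h.lower, h.upper, h.r_pos]

theorem u_gt (h : RadixParam v r u) : 1 < u := by
  rw [h.u_eq]
  nlinarith [h.r_mul, h.lower, h.upper, h.r_pos,
    mul_pos h.r_pos (mul_pos (sub_pos.2 h.upper) (sub_pos.2 h.lower))]

theorem u_lt (h : RadixParam v r u) : u < 117 / 100 := by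
  have h1 : 0 < 117 / 100 * (1 + v ^ 2) - (1 + v) := by
    nlinarith [sq_nonneg (v - 9 / 14), h.lower, h.upper]
  rw [h.u_eq]
  nlinarith [h.r_mul, mul_pos h.r_pos h1]

theorem u_sub_r_gt (h : RadixParam v r u) : 45 / 100 < u - r := by
  have h1 : 0 < v - 45 / 100 * (1 + v ^ 2) := by
    nlinarith [mul_pos (sub_pos.2 h.upper) (sub_pos.2 h.lower), h.lower, h.upper]
  rw [h.u_eq]
  nlinarith [h.r_mul, mul_pos h.r_pos h1]

theorem u_sub_r_lt (h : RadixParam v r u) : u - r < 1 / 2 := by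
  have h1 : 0 < (1 - v) ^ 2 := pow_pos (sub_pos.2 h.upper) 2
  rw [h.u_eq]
  nlinarith [h.r_mul, mul_pos h.r_pos h1]

theorem u_lt_two_mul (h : RadixParam v r u) : u < 2 * r := by
  rw [h.u_eq]
  nlinarith [h.upper, h.r_pos]

theorem two_lt (h : RadixParam v r u) : 2 < 3 * u - 2 * r := by
  have h1 : 0 < (2 * v - 1) * (1 - v) :=
    mul_pos (by linarith [h.lower]) (sub_pos.2 h.upper)
  rw [h.u_eq]
  nlinarith [h.r_mul, mul_pos h.r_pos h1]

theorem sq_sub (h : RadixParam v r u) : u ^ 2 - r = 2 * v * r ^ 2 := by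
  rw [h.u_eq]
  linear_combination r * h.r_mul

/-- The negative sign is what makes both old terms in `four_step` enter with negative coefficients.
-/
theorem cube_sub (h : RadixParam v r u) : u ^ 3 - 2 * u * r = -(u * r ^ 2 * (1 - v) ^ 2) := by
  have h2 : u ^ 2 - 2 * r = -(r ^ 2 * (1 - v) ^ 2) := by
    rw [h.u_eq]
    linear_combination 2 * r * h.r_mul
  linear_combination u * h2

theorem noise_lt (h : RadixParam v r u) : 1 + u + 2 * v * r ^ 2 < 282 / 100 := by
  have h1 : 0 < 65 / 100 * (1 + v ^ 2) ^ 2 - 2 * v := by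
    nlinarith [sq_nonneg (v - 9 / 14), sq_nonneg (v ^ 2 - 81 / 196), h.lower, h.upper]
  have h2 : 2 * v * r ^ 2 < 65 / 100 := by
    have h3 : r ^ 2 * (1 + v ^ 2) ^ 2 = 1 := by
      rw [← mul_pow, h.r_mul, one_pow]
    nlinarith [mul_pos (pow_pos h.r_pos 2) h1]
  have := h.u_lt
  linarith

theorem contraction_le (h : RadixParam v r u) :
    u * r ^ 2 * (1 - v) ^ 2 + r * (2 * v * r ^ 2) ≤ 55 / 100 := by
  have h1 : 0 ≤ 55 / 100 * (1 + v ^ 2) ^ 3 - ((1 + v) * (1 - v) ^ 2 + 2 * v) := by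
    have hv : 0 < v - 9 / 14 := sub_pos.2 h.lower
    have e : v = 9 / 14 + (v - 9 / 14) := by ring
    -- Recentred at 9/14, the polynomial has only positive coefficients.
    generalize v - 9 / 14 = d at *
    subst e
    ring_nf
    nlinarith [pow_pos hv 2, pow_pos hv 3, pow_pos hv 4, pow_pos hv 5, pow_pos hv 6]
  have h3 : r ^ 3 * (1 + v ^ 2) ^ 3 = 1 := by
    rw [← mul_pow, h.r_mul, one_pow]
  have h4 := mul_nonneg (pow_pos h.r_pos 3).le h1
  have h5 : u * r ^ 2 * (1 - v) ^ 2 + r * (2 * v * r ^ 2) =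
      r ^ 3 * ((1 + v) * (1 - v) ^ 2 + 2 * v) := by
    rw [h.u_eq]
    ring
  rw [h5]
  nlinarith

/-! ### Dynamics of the shift radix system -/

/-- Four steps of the recurrence contract the range of the sequence. -/
theorem four_step (h : RadixParam v r u) {b : ℕ → ℝ} {ρ : ℕ → ℝ} (h0 : ∀ n, 0 ≤ ρ n)
    (h1 : ∀ n, ρ n ≤ 1) (hb : ∀ n, b (n + 2) = ρ n + u * b (n + 1) - r * b n) {A B : ℝ}
    (hA : 0 ≤ A) (hB : 0 ≤ B) {n : ℕ} (hn : -A ≤ b n ∧ b n ≤ B)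
    (hn1 : -A ≤ b (n + 1) ∧ b (n + 1) ≤ B) :
    -(55 / 100 * B) ≤ b (n + 4) ∧ b (n + 4) < 282 / 100 + 55 / 100 * A := by
  set p := u * r ^ 2 * (1 - v) ^ 2 with hp
  set q := 2 * v * r ^ 2 with hq
  have hu0 : 0 < u := by linarith [h.u_gt]
  have hv0 : 0 < v := by linarith [h.lower]
  have hr0 := h.r_pos
  have hp0 : 0 ≤ p := by positivity
  have hq0 : 0 ≤ q := by positivity
  have hrq0 : 0 ≤ r * q := by positivity
  have hpq : p + r * q ≤ 55 / 100 := h.contraction_le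
  have hS : 1 + u + q < 282 / 100 := h.noise_lt
  -- Both old terms carry negative coefficients of total size at most 55/100, so the upper and lower
  -- bounds trade places.
  have e : b (n + 4) = ρ (n + 2) + u * ρ (n + 1) + q * ρ n - p * b (n + 1) - r * q * b n := by
    rw [hb (n + 2), hb (n + 1), hb n]
    linear_combination (ρ n + u * b (n + 1) - r * b n) * h.sq_sub - u * b (n + 1) * h.sq_sub
      + b (n + 1) * h.cube_sub
  have i1 := mul_nonneg hu0.le (h0 (n + 1))
  have i2 := mul_nonneg hq0 (h0 n)
  have i3 := mul_le_mul_of_nonneg_left (h1 (n + 1)) hu0.le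
  have i4 := mul_le_mul_of_nonneg_left (h1 n) hq0
  have j1 := mul_le_mul_of_nonneg_left hn1.1 hp0
  have j2 := mul_le_mul_of_nonneg_left hn1.2 hp0
  have j3 := mul_le_mul_of_nonneg_left hn.1 hrq0
  have j4 := mul_le_mul_of_nonneg_left hn.2 hrq0
  have k1 := mul_le_mul_of_nonneg_right hpq hA
  have k2 := mul_le_mul_of_nonneg_right hpq hB
  have := h0 (n + 2)
  have := h1 (n + 2)
  constructor <;> linarith

theorem abs_le_of_initial (h : RadixParam v r u) {b : ℕ → ℝ} {ρ : ℕ → ℝ} (h0 : ∀ n, 0 ≤ ρ n)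
    (h1 : ∀ n, ρ n ≤ 1) (hb : ∀ n, b (n + 2) = ρ n + u * b (n + 1) - r * b n) {K : ℝ}
    (hK : 7 ≤ K) (hi : ∀ n < 4, -K ≤ b n ∧ b n ≤ K) (n : ℕ) : -K ≤ b n ∧ b n ≤ K := by
  induction n using Nat.strong_induction_on with
  | _ n ih =>
    rcases lt_or_ge n 4 with hn | hn
    · exact hi n hn
    · obtain ⟨m, rfl⟩ := Nat.exists_eq_add_of_le' hn
      have := h.four_step h0 h1 hb (by linarith) (by linarith) (ih m (by omega))
        (ih (m + 1) (by omega))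
      constructor <;> linarith

/-- Every integer solution eventually takes values in `{-1, 0, 1, 2, 3}`. -/
theorem eventually_mem_Icc (h : RadixParam v r u) {a : ℕ → ℤ} {ρ : ℕ → ℝ} (h0 : ∀ n, 0 ≤ ρ n)
    (h1 : ∀ n, ρ n ≤ 1) (ha : ∀ n, (a (n + 2) : ℝ) = ρ n + u * a (n + 1) - r * a n) :
    ∃ m, ∀ n ≥ m, -1 ≤ a n ∧ a n ≤ 3 := by
  -- Integrality rounds each new bound. The lower condition is strict and the upper one is not,
  -- because `four_step` is strict only above.
  have improve : ∀ A B A' B' : ℤ, 0 ≤ A → 0 ≤ B → (55 * B < 100 * (A' + 1)) →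
      (282 + 55 * A ≤ 100 * (B' + 1)) →
      (∃ m, ∀ n ≥ m, -A ≤ a n ∧ a n ≤ B) → ∃ m, ∀ n ≥ m, -A' ≤ a n ∧ a n ≤ B' := by
    rintro A B A' B' hA hB hA' hB' ⟨m, hm⟩
    refine ⟨m + 4, fun n hn => ?_⟩
    obtain ⟨k, rfl⟩ := Nat.exists_eq_add_of_le' (show 4 ≤ n by omega)
    have c : ∀ i ≥ m, -(A : ℝ) ≤ a i ∧ (a i : ℝ) ≤ B := fun i hi => by
      exact_mod_cast hm i hi
    have := h.four_step h0 h1 (b := fun n => (a n : ℝ)) ha (by exact_mod_cast hA)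
      (by exact_mod_cast hB) (c k (by omega)) (c (k + 1) (by omega))
    have hA'' : (55 * B : ℝ) < 100 * (A' + 1) := by exact_mod_cast hA'
    have hB'' : (282 + 55 * A : ℝ) ≤ 100 * (B' + 1) := by exact_mod_cast hB'
    constructor
    · have : (-(A' + 1) : ℝ) < a (k + 4) := by linarith [this.1]
      have : -(A' + 1) < a (k + 4) := by exact_mod_cast this
      omega
    · have : (a (k + 4) : ℝ) < B' + 1 := by linarith [this.2]
      have : a (k + 4) < B' + 1 := by exact_mod_cast this
      omega
  -- A symmetric bound M drops to M − 1 as long as 282 + 55M ≤ 100M, that is, for integers M ≥ 7;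
  -- below that the two sides are improved separately.
  have descend : ∀ K : ℕ, (∃ m, ∀ n ≥ m, -((6 + K : ℕ) : ℤ) ≤ a n ∧ a n ≤ ((6 + K : ℕ) : ℤ)) →
      ∃ m, ∀ n ≥ m, -6 ≤ a n ∧ a n ≤ 6 := by
    intro K
    induction K with
    | zero => exact id
    | succ K ih =>
      intro hK
      exact ih (improve _ _ _ _ (by positivity) (by positivity) (by push_cast; omega)
        (by push_cast; omega) hK)
  have start : ∃ m, ∀ n ≥ m, -6 ≤ a n ∧ a n ≤ 6 := by
    set K : ℕ := 1 + (a 0).natAbs + (a 1).natAbs + (a 2).natAbs + (a 3).natAbs with hK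
    refine descend K ⟨0, fun n _ => ?_⟩
    have := h.abs_le_of_initial h0 h1 (b := fun n => (a n : ℝ)) ha (K := ((6 + K : ℕ) : ℝ))
      (by
        have : 7 ≤ 6 + K := by omega
        exact_mod_cast this)
      (fun n hn => by
        have : -((6 + K : ℕ) : ℤ) ≤ a n ∧ a n ≤ ((6 + K : ℕ) : ℤ) := by
          interval_cases n <;> omega
        exact_mod_cast this) n
    exact_mod_cast this
  have s1 := improve 6 6 3 6 (by norm_num) (by norm_num) (by norm_num) (by norm_num) start
  have s2 := improve 3 6 3 4 (by norm_num) (by norm_num) (by norm_num) (by norm_num) s1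
  have s3 := improve 3 4 2 4 (by norm_num) (by norm_num) (by norm_num) (by norm_num) s2
  have s4 := improve 2 4 2 3 (by norm_num) (by norm_num) (by norm_num) (by norm_num) s3
  exact improve 2 3 1 3 (by norm_num) (by norm_num) (by norm_num) (by norm_num) s4

/-- The shift radix system has no cycles apart from the two fixed points `(0, 0)` and
`(1, 1)`. -/
theorem exists_fixed (h : RadixParam v r u) {a : ℕ → ℤ} {ρ : ℕ → ℝ} (h0 : ∀ n, 0 ≤ ρ n)
    (h1 : ∀ n, ρ n < 1) (ha : ∀ n, (a (n + 2) : ℝ) = ρ n + u * a (n + 1) - r * a n) :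
    ∃ m, (a m = 0 ∧ a (m + 1) = 0) ∨ (a m = 1 ∧ a (m + 1) = 1) := by
  obtain ⟨k, hk⟩ := h.eventually_mem_Icc h0 (fun n => (h1 n).le) ha
  have b1 := h.r_gt
  have b2 := h.r_lt
  have b3 := h.u_gt
  have b4 := h.u_lt
  have b5 := h.u_sub_r_gt
  have b6 := h.u_sub_r_lt
  have b7 := h.u_lt_two_mul
  have b8 := h.two_lt
  by_contra! hno
  -- If (p, q) can only be followed by s and (q, s) is excluded, so is (p, q). Where the recurrence
  -- alone does not pin s, the window end −1 or 3 does. The exclusions below run backwards from (0,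
  -- 0) and (1, 1).
  have step : ∀ p q s : ℤ, ((s : ℝ) - 1 < u * q - r * p ∨ s = -1) →
      (u * q - r * p ≤ s ∨ s = 3) → (∀ n ≥ k, a n = q → a (n + 1) ≠ s) →
      ∀ n ≥ k, a n = p → a (n + 1) ≠ q := by
    intro p q s hs1 hs2 hs n hn hp hq
    have e := ha n
    rw [hp, hq] at e
    have i0 := h0 n
    have i1 := h1 n
    have hb := hk (n + 2) (by omega)
    refine hs (n + 1) (by omega) hq (le_antisymm ?_ ?_ : a (n + 2) = s)
    · rcases hs2 with h | rfl
      · have : (a (n + 2) : ℝ) < s + 1 := by linarith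
        have : a (n + 2) < s + 1 := by exact_mod_cast this
        omega
      · exact hb.2
    · rcases hs1 with h | rfl
      · have : (s : ℝ) - 1 < a (n + 2) := by linarith
        have : s - 1 < a (n + 2) := by exact_mod_cast this
        omega
      · exact hb.1
  have n00 : ∀ n ≥ k, a n = 0 → a (n + 1) ≠ 0 := fun n _ h => (hno n).1 h
  have n11 : ∀ n ≥ k, a n = 1 → a (n + 1) ≠ 1 := fun n _ h => (hno n).2 h
  have n10 := step 1 0 0 (Or.inl (by norm_num; linarith)) (Or.inl (by norm_num; linarith)) n00
  have n21 := step 2 1 0 (Or.inl (by norm_num; linarith)) (Or.inl (by norm_num; linarith)) n10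
  have n31 := step 3 1 0 (Or.inl (by norm_num; linarith)) (Or.inl (by norm_num; linarith)) n10
  have n22 := step 2 2 1 (Or.inl (by norm_num; linarith)) (Or.inl (by norm_num; linarith)) n21
  have n32 := step 3 2 1 (Or.inl (by norm_num; linarith)) (Or.inl (by norm_num; linarith)) n21
  have n12 := step 1 2 2 (Or.inl (by norm_num; linarith)) (Or.inl (by norm_num; linarith)) n22
  have n33 := step 3 3 2 (Or.inl (by norm_num; linarith)) (Or.inl (by norm_num; linarith)) n32
  have n23 := step 2 3 3 (Or.inl (by norm_num; linarith)) (Or.inr rfl) n33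
  have n13 := step 1 3 3 (Or.inl (by norm_num; linarith)) (Or.inr rfl) n33
  have z1 := step 0 1 2 (Or.inl (by norm_num; linarith)) (Or.inl (by norm_num; linarith)) n12
  have z2 := step 0 2 3 (Or.inl (by norm_num; linarith)) (Or.inr rfl) n23
  have z3 := step 0 3 3 (Or.inl (by norm_num; linarith)) (Or.inr rfl) n33
  have m0 := step (-1) 0 1 (Or.inl (by norm_num; linarith)) (Or.inl (by norm_num; linarith)) z1
  have mm := step (-1) (-1) 0 (Or.inl (by norm_num; linarith)) (Or.inl (by norm_num; linarith)) m0
  have zm := step 0 (-1) (-1) (Or.inr rfl) (Or.inl (by norm_num; linarith)) mm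
  have om := step 1 (-1) (-1) (Or.inr rfl) (Or.inl (by norm_num; linarith)) mm
  have tm := step 2 (-1) (-1) (Or.inr rfl) (Or.inl (by norm_num; linarith)) mm
  have hm := step 3 (-1) (-1) (Or.inr rfl) (Or.inl (by norm_num; linarith)) mm
  have hneg : ∀ n ≥ k, a (n + 1) ≠ -1 := by
    intro n hn hq
    have := hk n hn
    have := mm n hn
    have := zm n hn
    have := om n hn
    have := tm n hn
    have := hm n hn
    omega
  have hzero : ∀ n ≥ k, a (n + 1) ≠ 0 := by
    intro n hn hq
    have e0 := hk (n + 2) (by omega)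
    have e1 := n00 (n + 1) (by omega) hq
    have e2 := z1 (n + 1) (by omega) hq
    have e3 := z2 (n + 1) (by omega) hq
    have e4 := z3 (n + 1) (by omega) hq
    have e5 := hneg (n + 1) (by omega)
    simp only [add_assoc, Nat.reduceAdd] at e1 e2 e3 e4 e5
    omega
  have e0 := hk (k + 1) (by omega)
  have e1 := hk (k + 2) (by omega)
  have f0 := hneg k le_rfl
  have f1 := hneg (k + 1) (by omega)
  have f2 := hzero k le_rfl
  have f3 := hzero (k + 1) (by omega)
  have g1 := n11 (k + 1) (by omega)
  have g2 := n12 (k + 1) (by omega)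
  have g3 := n13 (k + 1) (by omega)
  have g4 := n21 (k + 1) (by omega)
  have g5 := n22 (k + 1) (by omega)
  have g6 := n23 (k + 1) (by omega)
  have g7 := n31 (k + 1) (by omega)
  have g8 := n32 (k + 1) (by omega)
  have g9 := n33 (k + 1) (by omega)
  simp only [add_assoc, Nat.reduceAdd] at f1 f3 g1 g2 g3 g4 g5 g6 g7 g8 g9
  omega

/-- The fixed point `(1, 1)` has no preimage but itself. -/
theorem eq_one_of_eventually (h : RadixParam v r u) {a : ℕ → ℤ} {ρ : ℕ → ℝ}
    (h0 : ∀ n, 0 ≤ ρ n) (h1 : ∀ n, ρ n < 1)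
    (ha : ∀ n, (a (n + 2) : ℝ) = ρ n + u * a (n + 1) - r * a n) (m : ℕ)
    (hm : a m = 1 ∧ a (m + 1) = 1) : a 0 = 1 ∧ a 1 = 1 := by
  induction m with
  | zero => exact hm
  | succ m ih =>
    refine ih ⟨?_, hm.1⟩
    have e := ha m
    rw [show a (m + 2) = 1 from hm.2, hm.1] at e
    push_cast at e
    have i0 := h0 m
    have i1 := h1 m
    have b1 := h.r_gt
    have b3 := h.u_gt
    have b7 := h.u_lt_two_mul
    -- Here r a(m) = ρ + u − 1 lies in (0, 2r), since 1 < u < 2r.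
    have p1 : (0 : ℝ) < a m := by
      by_contra! hc
      nlinarith
    have p2 : (a m : ℝ) < 2 := by
      by_contra! hc
      nlinarith
    have p1' : 0 < a m := by exact_mod_cast p1
    have p2' : a m < 2 := by exact_mod_cast p2
    omega

end RadixParam

/-! ### Finite expansions of the nonnegative integers -/

theorem betaT_iterate_zero (β : ℝ) (n : ℕ) : (betaT β)^[n] 0 = 0 :=
  Function.iterate_fixed (by simp [betaT]) n

theorem finite_betaDigit_of_iterate_eq_zero {β x : ℝ} {m : ℕ} (h : (betaT β)^[m] x = 0) :
    {n : ℕ | betaDigit β x n ≠ 0}.Finite := by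
  refine (Set.finite_lt_nat m).subset fun n hn => ?_
  by_contra hc
  obtain ⟨k, rfl⟩ := Nat.exists_eq_add_of_le' (not_lt.1 hc)
  refine hn ?_
  simp [betaDigit, Function.iterate_add_apply, h, betaT_iterate_zero]

/-- An element of `ℤ[β] ∩ [0, 1)` other than the fixed point with coordinates `(1, 1)` has an
orbit ending in `0`. -/
theorem exists_iterate_eq_zero {β v r u : ℝ} {t : ℕ} (h : RadixParam v r u) (hr : β * r = t)
    (hu : β * u = 2 * t - r) (hβ : β = 2 * t - u) {A B : ℤ} (hAB : ¬(A = 1 ∧ B = 1)) :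
    ∃ m, (betaT β)^[m] (Int.fract (r * A - u * B)) = 0 := by
  have it := betaT_iterate_fract hr hu hβ 0 A B
  have rec' := radixSeq_add_two β r u 0 A B
  have z0 : radixSeq β r u 0 A B 0 = A := by rw [radixSeq]
  have z1 : radixSeq β r u 0 A B 1 = B := by rw [radixSeq]
  generalize radixSeq β r u 0 A B = a at *
  simp only [zero_mul, zero_add, sub_zero] at it rec'
  have q0 : ∀ n, 0 ≤ Int.fract (r * a n - u * a (n + 1)) := fun n => Int.fract_nonneg _
  have q1 : ∀ n, Int.fract (r * a n - u * a (n + 1)) < 1 := fun n => Int.fract_lt_one _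
  obtain ⟨m, hm | hm⟩ := h.exists_fixed q0 q1 rec'
  · exact ⟨m, by rw [it, hm.1, hm.2]; simp⟩
  · have := h.eq_one_of_eventually q0 q1 rec' m hm
    rw [z0, z1] at this
    exact absurd this hAB

/-- The fractional part of a nonnegative integer never has the coordinates `(1, 1)`. -/
theorem radixSeq_ne_one {β v r u : ℝ} (h : RadixParam v r u) (hβ : 14 / 5 < β) {N L : ℕ}
    (hL : (N : ℝ) / β ^ L < 1) (hmin : ∀ n < L, 1 ≤ (N : ℝ) / β ^ n) :
    ¬(radixSeq β r u (N / β ^ L) 0 0 L = 1 ∧ radixSeq β r u (N / β ^ L) 0 0 (L + 1) = 1) := by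
  have hβ0 : 0 < β := by linarith
  set x : ℝ := N / β ^ L with hx
  have hx0 : 0 ≤ x := by positivity
  have rec' := radixSeq_add_two β r u x 0 0
  have z0 : radixSeq β r u x 0 0 0 = 0 := by rw [radixSeq]
  have z1 : radixSeq β r u x 0 0 1 = 0 := by rw [radixSeq]
  have z2 : radixSeq β r u x 0 0 2 = 0 := by
    rw [radixSeq, z0, z1]
    simpa using Int.floor_eq_zero_iff.2 ⟨hx0, hL⟩
  have z3 : radixSeq β r u x 0 0 3 ≤ 0 := by
    rw [radixSeq, z1, z2]
    simp only [neg_nonpos, Int.floor_nonneg]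
    simp only [Int.cast_zero, mul_zero, sub_zero, add_zero]
    positivity
  generalize radixSeq β r u x 0 0 = a at *
  rintro ⟨e1, e2⟩
  -- The entries of index at most 3 are nonpositive, so a(L) = 1 forces L > 3 and hence N ≥ β³.
  have hL4 : 3 < L := by
    by_contra! hc
    interval_cases L <;> omega
  have hN : β ^ 3 ≤ N := by
    have := hmin 3 hL4
    rwa [le_div_iff₀ (by positivity), one_mul] at this
  have b1 := h.r_gt
  have b2 := h.r_lt
  have b3 := h.u_gt
  have b4 := h.u_lt
  set D := β ^ 2 - u * β + r with hD
  have hD1 : D ≤ β ^ 2 := by nlinarith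
  have hD2 : β ^ 2 / 2 ≤ D := by nlinarith
  have hD0 : 0 < D := by nlinarith
  -- Adding y βⁿ cancels the inhomogeneous term, as D is the characteristic polynomial at β; the sum
  -- then obeys the contraction and stays within 7.
  set y := x / D with hy
  have hyD : y * D = x := div_mul_cancel₀ _ hD0.ne'
  have hy0 : 0 ≤ y := by positivity
  have hy2 : y * β ^ 2 ≤ 2 := by nlinarith
  have hy1 : y * β ≤ 2 := by nlinarith
  have hy0' : y ≤ 2 := by nlinarith
  set ρ : ℕ → ℝ := fun n => Int.fract (x * β ^ n + r * a n - u * a (n + 1)) with hρ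
  have q0 : ∀ n, 0 ≤ ρ n := fun n => Int.fract_nonneg _
  have q1 : ∀ n, ρ n ≤ 1 := fun n => (Int.fract_lt_one _).le
  have hb : ∀ n, (a (n + 2) + y * β ^ (n + 2) : ℝ) =
      ρ n + u * (a (n + 1) + y * β ^ (n + 1)) - r * (a n + y * β ^ n) := by
    intro n
    rw [rec' n]
    simp only [hρ]
    linear_combination (β ^ n) * hyD
  have hi : ∀ n < 4, -7 ≤ (a n + y * β ^ n : ℝ) ∧ (a n + y * β ^ n : ℝ) ≤ 7 := by
    have i3 := hb 1
    norm_num [z0, z1, z2] at i3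
    intro n hn
    interval_cases n
    · simp [z0]; constructor <;> linarith
    · have : 0 ≤ y * β := by positivity
      simp [z1]; constructor <;> linarith
    · have : 0 ≤ y * β ^ 2 := by positivity
      simp [z2]; constructor <;> linarith
    · have : 0 ≤ y * β := by positivity
      have : 0 ≤ y * β ^ 2 := by positivity
      have := q0 1
      have := q1 1
      rw [i3]
      constructor <;> nlinarith
  have key := (h.abs_le_of_initial q0 q1 (b := fun n => (a n + y * β ^ n : ℝ)) hb le_rfl hi
    (L + 1)).2
  simp only [e2] at key
  push_cast at key
  have hyN : y * β ^ L * D = N := by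
    rw [mul_right_comm, hyD, hx]
    field_simp
  have hyL : 0 ≤ y * β ^ L := by positivity
  -- Now y β^(L+1) ≤ 6, whereas D ≤ β² and N ≥ β³ give y β^(L+1) ≥ β² > 6.
  rw [pow_succ, ← mul_assoc] at key
  nlinarith [mul_le_mul_of_nonneg_left hD1 hyL, mul_le_mul_of_nonneg_left key hβ0.le]

theorem natCast_mem_betaFin {β v r u : ℝ} {t : ℕ} (h : RadixParam v r u) (hβ : 14 / 5 < β)
    (hr : β * r = t) (hu : β * u = 2 * t - r) (hut : β = 2 * t - u) (N : ℕ) :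
    (N : ℝ) ∈ betaFin β := by
  refine ⟨N.cast_nonneg, ?_⟩
  have hβ1 : 1 < β := by linarith
  have hβ0 : 0 < β := by linarith
  have hne : {n : ℕ | (N : ℝ) / β ^ n < 1}.Nonempty := by
    obtain ⟨n, hn⟩ := pow_unbounded_of_one_lt (N : ℝ) hβ1
    exact ⟨n, (div_lt_one (by positivity)).2 hn⟩
  have hL : (N : ℝ) / β ^ betaL β N < 1 := Nat.sInf_mem hne
  have hmin : ∀ n < betaL β N, 1 ≤ (N : ℝ) / β ^ n := fun n hn =>
    not_lt.1 (Nat.notMem_of_lt_sInf hn)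
  generalize betaL β N = L at *
  have hx0 : 0 ≤ (N : ℝ) / β ^ L := by positivity
  have it := betaT_iterate_fract hr hu hut (N / β ^ L) 0 0 L
  obtain ⟨m, hm⟩ := exists_iterate_eq_zero h hr hu hut (radixSeq_ne_one h hβ hL hmin)
  -- At time L the inhomogeneous term equals the integer N and drops out of the fractional part.
  rw [div_mul_cancel₀ _ (by positivity), add_sub_assoc (N : ℝ), Int.fract_natCast_add] at it
  simp only [Int.cast_zero, mul_zero, add_zero, sub_zero] at it
  rw [Int.fract_eq_self.2 ⟨hx0, hL⟩] at it
  refine finite_betaDigit_of_iterate_eq_zero (m := m + L) ?_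
  rw [Function.iterate_add_apply, it, hm]

/-! ### The root of the cubic -/

/-- The cubic says t(β² + (β − 1)²) = β³, which is r(1 + v²) = 1 after division by β³. The bound
14/5 becomes 9/14 = 1 − 5/14. -/
theorem radixParam_of_root {β : ℝ} {t : ℕ} (hβ : 14 / 5 < β)
    (hf : β ^ 3 - 2 * t * β ^ 2 + 2 * t * β - t = 0) :
    RadixParam (1 - 1 / β) (t / β) (2 * t - β) where
  lower := by
    have : 1 / β < 1 / (14 / 5) := one_div_lt_one_div_of_lt (by norm_num) hβ
    linarith
  upper := by
    have : 0 < 1 / β := by positivity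
    linarith
  r_mul := by
    have : β ≠ 0 := by positivity
    field_simp
    linear_combination -hf
  u_eq := by
    have : β ≠ 0 := by positivity
    field_simp
    linear_combination -hf

/-- On (1, 2] the cubic is at most β(β − 2)² − 2 < 0, so β > 2. The bound 2t − 2 already exceeds
14/5 for t ≥ 3; only t = 2 needs separate care. -/
theorem root_bounds {β : ℝ} {t : ℕ} (ht : 2 ≤ t) (hβ : 1 < β)
    (hf : β ^ 3 - 2 * t * β ^ 2 + 2 * t * β - t = 0) :
    2 * (t : ℝ) - 2 < β ∧ 14 / 5 < β := by
  have ht' : (2 : ℝ) ≤ t := by exact_mod_cast ht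
  have h2 : 2 < β := by
    by_contra! hc
    nlinarith [mul_nonneg (sub_nonneg.2 ht') (add_nonneg (sq_nonneg β) (sq_nonneg (β - 1))),
      mul_nonneg (sub_nonneg.2 hc) (sub_nonneg.2 hβ.le),
      mul_nonneg (sub_nonneg.2 hβ.le) (mul_nonneg (sub_nonneg.2 hc) (sub_nonneg.2 hβ.le))]
  have hlow : 2 * (t : ℝ) - 2 < β := by
    by_contra! hc
    nlinarith [mul_nonneg (mul_nonneg (sub_nonneg.2 hc) (sub_nonneg.2 h2.le))
      (by linarith : (0 : ℝ) ≤ β)]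
  refine ⟨hlow, ?_⟩
  rcases ht.eq_or_lt with rfl | h3
  · by_contra! hc
    push_cast at hf
    nlinarith [mul_nonneg (sub_nonneg.2 hc) (sub_nonneg.2 h2.le),
      mul_nonneg (mul_nonneg (sub_nonneg.2 hc) (sub_nonneg.2 h2.le))
        (by linarith : (0 : ℝ) ≤ β)]
  · have : (3 : ℝ) ≤ t := by exact_mod_cast h3
    linarith

/-- The cubic equals 1 − t at 1 and t − 1 at 2t − 1. Two distinct roots would make its difference
quotient vanish, but this is positive when both exceed 2t − 2. -/
theorem existsUnique_root {t : ℕ} (ht : 2 ≤ t) :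
    ∃! β : ℝ, 1 < β ∧ β ^ 3 - 2 * t * β ^ 2 + 2 * t * β - t = 0 := by
  have ht' : (2 : ℝ) ≤ t := by exact_mod_cast ht
  have hcont : ContinuousOn (fun β : ℝ => β ^ 3 - 2 * t * β ^ 2 + 2 * t * β - t)
      (Set.Icc 1 (2 * t - 1)) := by fun_prop
  obtain ⟨β, hβ, hf⟩ := intermediate_value_Ioo (by linarith) hcont
    (show (0 : ℝ) ∈ Set.Ioo _ _ by constructor <;> ring_nf <;> nlinarith)
  refine ⟨β, ⟨hβ.1, hf⟩, fun γ ⟨hγ, hg⟩ => ?_⟩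
  have hf' : β ^ 3 - 2 * t * β ^ 2 + 2 * t * β - t = 0 := hf
  obtain ⟨l1, -⟩ := root_bounds ht hβ.1 hf'
  obtain ⟨l2, -⟩ := root_bounds ht hγ hg
  have hprod : (γ - β) * (γ ^ 2 + γ * β + β ^ 2 - 2 * t * (γ + β) + 2 * t) = 0 := by
    linear_combination hg - hf'
  rcases mul_eq_zero.1 hprod with h | h
  · linarith
  · exfalso
    nlinarith [mul_pos (sub_pos.2 l1) (sub_pos.2 l2), sq_nonneg (β - (2 * t - 2)),
      sq_nonneg (γ - (2 * t - 2)), mul_nonneg (sub_nonneg.2 ht') (sub_pos.2 l1).le,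
      mul_nonneg (sub_nonneg.2 ht') (sub_pos.2 l2).le, sq_nonneg ((t : ℝ) - 2)]

/-! ### Failure of (PF) -/

/-- The number `(t - 1) / (β - 1)`, with all digits `t - 1`, is a polynomial expression in `1 / β`
with nonnegative coefficients. -/
theorem periodic_mem_adjoin {β : ℝ} {t : ℕ} (ht : 2 ≤ t) (hβ : 1 < β)
    (hf : β ^ 3 - 2 * t * β ^ 2 + 2 * t * β - t = 0) :
    ((t : ℝ) - 1) / (β - 1) ∈ Algebra.adjoin ℕ {1 / β} := by
  obtain ⟨s, rfl⟩ := Nat.exists_eq_add_of_le' ht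
  have hX : 1 / β ∈ Algebra.adjoin ℕ {1 / β} := Algebra.subset_adjoin rfl
  have e : (((s + 2 : ℕ) : ℝ) - 1) / (β - 1) = (s : ℝ) * (1 / β) +
      ((3 * s + 4 : ℕ) : ℝ) * (1 / β) ^ 2 + ((s + 1 : ℕ) : ℝ) * (1 / β) ^ 3 +
      ((s + 2 : ℕ) : ℝ) * (1 / β) ^ 6 := by
    have h0 : β ≠ 0 := by positivity
    have h1 : β - 1 ≠ 0 := by linarith
    push_cast at hf ⊢
    field_simp
    -- With denominators cleared, the two sides differ by this multiple of the cubic.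
    linear_combination (β ^ 3 - β - 1) * hf
  rw [e]
  exact add_mem (add_mem (add_mem (mul_mem (natCast_mem _ _) hX)
    (mul_mem (natCast_mem _ _) (pow_mem hX 2))) (mul_mem (natCast_mem _ _) (pow_mem hX 3)))
    (mul_mem (natCast_mem _ _) (pow_mem hX 6))

/-- Since t < β, the number lies in [0, 1) and is fixed by `betaT`, so every digit is t − 1 ≠ 0. -/
theorem periodic_notMem_betaFin {β : ℝ} {t : ℕ} (ht : 2 ≤ t) (hβ : (t : ℝ) < β) :
    ((t : ℝ) - 1) / (β - 1) ∉ betaFin β := by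
  have ht' : (2 : ℝ) ≤ t := by exact_mod_cast ht
  set x : ℝ := ((t : ℝ) - 1) / (β - 1) with hx
  have hx0 : 0 ≤ x := div_nonneg (by linarith) (by linarith)
  have hx1 : x < 1 := (div_lt_one (by linarith)).2 (by linarith)
  have hmul : β * x = ((t - 1 : ℤ) : ℝ) + x := by
    have : x * (β - 1) = t - 1 := div_mul_cancel₀ _ (by linarith)
    push_cast
    linarith
  have hfix : betaT β x = x := by
    rw [betaT, hmul, Int.fract_intCast_add, Int.fract_eq_self.2 ⟨hx0, hx1⟩]
  have hL : betaL β x = 0 := Nat.sInf_eq_zero.2 (Or.inl (by simpa using hx1))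
  rintro ⟨-, hfin⟩
  rw [hL, pow_zero, div_one] at hfin
  refine Set.infinite_univ (hfin.subset fun n _ => ?_)
  have : betaDigit β x n = t - 1 := by
    rw [betaDigit, Function.iterate_fixed hfix, hmul, Int.floor_intCast_add,
      Int.floor_eq_zero_iff.2 ⟨hx0, hx1⟩, add_zero]
  simp only [Set.mem_ofPred_eq, this]
  omega

theorem theorem1p2 (t : ℕ) (ht : 2 ≤ t) :
    (∃! β : ℝ, 1 < β ∧ β ^ 3 - 2 * t * β ^ 2 + 2 * t * β - t = 0) ∧
    ∀ β : ℝ, 1 < β → β ^ 3 - 2 * t * β ^ 2 + 2 * t * β - t = 0 →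
      PropertyF1 β ∧ ¬ PropertyPF β := by
  refine ⟨existsUnique_root ht, fun β hβ hf => ?_⟩
  have ht' : (2 : ℝ) ≤ t := by exact_mod_cast ht
  obtain ⟨l1, l3⟩ := root_bounds ht hβ hf
  have h0 : β ≠ 0 := by positivity
  refine ⟨fun N => natCast_mem_betaFin (t := t) (radixParam_of_root l3 hf) l3
    (mul_div_cancel₀ _ h0) ?_ (by ring) N, fun hPF => ?_⟩
  · field_simp
    linear_combination -hf
  · exact periodic_notMem_betaFin ht (by linarith) (hPF (periodic_mem_adjoin ht hβ hf))
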